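/- For an integer $n\ge 0$ let $N=2^n$, and let $S\subseteq\{0,1\}^n$ be a nonempty set of $M=|S|$ marked bit strings whose Hamming weights are $n_1,\dots,n_M$, such that $|S_1\rangle=\frac1{\sqrt M}\sum_{x\in S}|x\rangle$ is symmetric, i.e. invariant under all permutations of the $n$ qubits. Let $|\psi_0\rangle=\frac1{\sqrt N}\sum_{x\in\{0,1\}^n}|x\rangle$, and let $|\psi_k\rangle=G^k|\psi_0\rangle$ be the state after $k$ iterations of Grover's algorithm, where $G=(2|\psi_0\rangle\langle\psi_0|-I)\,O$, with $O|x\rangle=-|x\rangle$ for $x\in S$ and $O|x\rangle=|x\rangle$ for $x\notin S$. Put $\theta=\arcsin\sqrt{M/N}$, let $k_{opt}$ be the integer closest to $\frac12\left(\frac{\pi}{2\theta}-1\right)$, and let $E(|\psi\rangle)=1-\max_\phi|\langle\psi|\phi\rangle|^2$ be the geometric measure of entanglement, where $|\phi\rangle=\bigotimes_{s=1}^n|\phi_s\rangle$ ranges over all products of single-qubit pure states. Finally, let $$B(\alpha)=\frac1{\sqrt M}\sum_{i=1}^M\cos^{n-n_i}\frac\alpha2\,\sin^{n_i}\frac\alpha2,\qquad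 B_{\max}=\max_{\alpha\in[0,\pi]}B(\alpha).$$ Let $\mathcal C$ be any class of such search problems $(n,S)$. Then the following are equivalent. 1. The entanglement dynamics is scale invariant for $N\gg M$, i.e. it asymptotically depends only on $k/k_{opt}$: there is a function $F:\mathbb R\to\mathbb R$ such that for every $\varepsilon>0$ there is a $\delta>0$ such that $|E(|\psi_k\rangle)-F(k/k_{opt})|<\varepsilon$ for all problems in $\mathcal C$ with $M/N<\delta$ and all $k\in\{0,1,\dots,k_{opt}\}$. 2. For $N\gg M$ the maximum of $B$ is asymptotically independent of $M$, $n$ and the $n_i$: there is a constant $c$ such that for every $\varepsilon>0$ there is a $\delta>0$ such that $|B_{\max}-c|<\varepsilon$ for all problems in $\mathcal C$ with $M/N<\delta$. -/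

import Mathlib

namespace Grover

/-- The state space of `n` qubits; computational basis states are the bit strings
`x : Fin n → Bool`, and `v x` is the amplitude of `|x⟩`. -/
abbrev QState (n : ℕ) : Type := EuclideanSpace ℂ (Fin n → Bool)

/-- The Hamming weight `|x|` of a bit string. -/
def hammingWeight {n : ℕ} (x : Fin n → Bool) : ℕ :=
  (Finset.univ.filter fun i => x i = true).card

/-- The uniform superposition `|ψ₀⟩ = (1/√N) ∑ₓ |x⟩`, with `N = 2 ^ n`. -/
noncomputable def uniformState (n : ℕ) : QState n :=
  WithLp.toLp 2 fun _ => ((1 / Real.sqrt ((2 : ℝ) ^ n) : ℝ) : ℂ)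

/-- A state is symmetric if it is unchanged by every permutation of the qubits. -/
def IsSymmetricState {n : ℕ} (v : QState n) : Prop :=
  ∀ (σ : Equiv.Perm (Fin n)) (x : Fin n → Bool), v (x ∘ σ) = v x

/-- The product (fully separable) pure state `⨂ₛ |φₛ⟩` of single-qubit vectors `φₛ`. -/
noncomputable def productState {n : ℕ} (φ : Fin n → EuclideanSpace ℂ Bool) : QState n :=
  WithLp.toLp 2 fun x => ∏ s, φ s (x s)

/-- The geometric measure of entanglement `E(|ψ⟩) = 1 - max_φ |⟨ψ|φ⟩|²`, the maximum being over
all products `φ` of single-qubit pure (unit) states. The set of overlaps is nonempty and compact,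
so that its supremum is a maximum. -/
noncomputable def gme {n : ℕ} (ψ : QState n) : ℝ :=
  1 - sSup {r : ℝ | ∃ φ : Fin n → EuclideanSpace ℂ Bool,
    (∀ s, ‖φ s‖ = 1) ∧ r = ‖inner ℂ ψ (productState φ)‖ ^ 2}

/-- An unstructured search problem: a number `n` of qubits, and the set of marked bit strings
among the `N = 2 ^ n` items. -/
structure SearchProblem where
  /-- the number of qubits -/
  n : ℕ
  /-- the set of marked items -/
  marked : Finset (Fin n → Bool)

namespace SearchProblem

variable (P : SearchProblem)

/-- The number `N = 2 ^ n` of items, as a real number. -/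
noncomputable def N : ℝ := (2 : ℝ) ^ P.n

/-- The number `M` of marked items, as a real number. -/
noncomputable def M : ℝ := (P.marked.card : ℝ)

/-- `|S₁⟩ = (1/√M) ∑ |x⟩`, the sum being over the marked `x`. -/
noncomputable def solutionState : QState P.n :=
  WithLp.toLp 2 fun x => if x ∈ P.marked then ((1 / Real.sqrt P.M : ℝ) : ℂ) else 0

/-- The oracle: `|x⟩ ↦ -|x⟩` for marked `x`, and `|x⟩ ↦ |x⟩` for unmarked `x`. -/
noncomputable def oracle (v : QState P.n) : QState P.n :=
  WithLp.toLp 2 fun x => if x ∈ P.marked then -v x else v x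

/-- The Grover iteration `G = (2|ψ₀⟩⟨ψ₀| - 1) ∘ oracle`. -/
noncomputable def groverStep (v : QState P.n) : QState P.n :=
  (2 * inner ℂ (uniformState P.n) (P.oracle v)) • uniformState P.n - P.oracle v

/-- The state `|ψ_{k,M}⟩ = G^k |ψ₀⟩` after `k` iterations. -/
noncomputable def stateAfter (k : ℕ) : QState P.n :=
  P.groverStep^[k] (uniformState P.n)

/-- The angle `θ = arcsin √(M/N)`. -/
noncomputable def angle : ℝ := Real.arcsin (Real.sqrt (P.M / P.N))

/-- The optimal number of iterations, the integer closest to `(π/(2θ) - 1)/2`. -/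
noncomputable def kOpt : ℕ := (round ((Real.pi / (2 * P.angle) - 1) / 2)).toNat

/-- `B(α) = (1/√M) ∑ cos^{n-|x|}(α/2) sin^{|x|}(α/2)`, the sum being over the marked `x`. -/
noncomputable def B (α : ℝ) : ℝ :=
  1 / Real.sqrt P.M * ∑ x ∈ P.marked,
    Real.cos (α / 2) ^ (P.n - hammingWeight x) * Real.sin (α / 2) ^ hammingWeight x

/-- The maximum of `B` over `[0, π]` (a continuous function on a compact interval). -/
noncomputable def BMax : ℝ := sSup (P.B '' Set.Icc 0 Real.pi)

end SearchProblem

/-- The entanglement dynamics of the search problems in the class `C` is scale invariant for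
`N ≫ M`: up to an error that vanishes, uniformly in the iteration `k ≤ k_opt` and in the problem,
as `M/N → 0`, the entanglement after `k` iterations is a function of `k/k_opt` alone. -/
def ScaleInvariant (C : Set SearchProblem) : Prop :=
  ∃ F : ℝ → ℝ, ∀ ε > 0, ∃ δ > 0, ∀ P ∈ C, P.M / P.N < δ → ∀ k ≤ P.kOpt,
    |gme (P.stateAfter k) - F ((k : ℝ) / (P.kOpt : ℝ))| < ε

/-- For `N ≫ M` the maximum of `B` does not depend on the problem in the class `C`, that is, on
`n`, on `M` or on the Hamming weights: it is the same constant for all of them, up to an error that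
vanishes, uniformly in the problem, as `M/N → 0`. -/
def BMaxIndependent (C : Set SearchProblem) : Prop :=
  ∃ c : ℝ, ∀ ε > 0, ∃ δ > 0, ∀ P ∈ C, P.M / P.N < δ → |P.BMax - c| < ε

end Grover

/-! Put t = 2kθ. The iterates stay in the plane of |ψ₀⟩ and |S₁⟩, and for M ≪ N the k-th one is
close to cos t |ψ₀⟩ + sin t |S₁⟩ (`stateAfter_eq`, `amplitudes_close`). A product vector cannot
overlap appreciably with both: overlaps A and B satisfy A⁸B⁴ ≤ M/N
(`univ_overlap_mul_setOverlap_le`). So the largest overlap with the sum is about the larger of the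
separate maxima: |cos t|, as |ψ₀⟩ is itself a product, and |sin t| · `BMax`, as the best product for
a symmetric |S₁⟩ may be taken with equal, real, nonnegative qubits (`setOverlap_marked_le_BMax`).
Hence E ≈ 1 - max(|cos t|, |sin t| · `BMax`)², uniformly in k (`abs_gme_sub_le`).

Since 2θ · `kOpt` ≈ π/2, t is about (π/2) · k/`kOpt`, and `BMax` is the only other dependence on the
problem. Conversely, k = `kOpt` gives E ≈ 1 - `BMax`², so the dynamics determines `BMax`. -/

namespace Grover

/-! ### Overlaps of real product vectors with sets of strings -/

/-- The amplitude at `x` of the product of the real single-qubit vectors `u s`. -/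
def amplitude {n : ℕ} (u : Fin n → Bool → ℝ) (x : Fin n → Bool) : ℝ := ∏ s, u s (x s)

/-- The overlap of a real product vector with the uniform superposition over `T`. -/
noncomputable def setOverlap {n : ℕ} (T : Finset (Fin n → Bool)) (u : Fin n → Bool → ℝ) : ℝ :=
  1 / Real.sqrt (T.card : ℝ) * ∑ x ∈ T, amplitude u x

/-- Real single-qubit vectors with nonnegative entries and unit norm. -/
structure IsNonnegUnit {n : ℕ} (u : Fin n → Bool → ℝ) : Prop where
  nonneg : ∀ s y, 0 ≤ u s y
  norm_eq : ∀ s, u s false ^ 2 + u s true ^ 2 = 1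

lemma amplitude_nonneg {n : ℕ} {u : Fin n → Bool → ℝ} (hu : IsNonnegUnit u)
    (x : Fin n → Bool) : 0 ≤ amplitude u x :=
  Finset.prod_nonneg fun s _ => hu.nonneg s _

lemma sum_amplitude_pow {n : ℕ} (u : Fin n → Bool → ℝ) (m : ℕ) :
    ∑ x, amplitude u x ^ m = ∏ s, (u s false ^ m + u s true ^ m) := by
  have h := Finset.prod_univ_sum (fun _ : Fin n => (Finset.univ : Finset Bool))
    (fun s y => u s y ^ m)
  rw [Fintype.piFinset_univ] at h
  simp only [amplitude, ← Finset.prod_pow]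
  rw [← h]
  refine Finset.prod_congr rfl fun s _ => ?_
  rw [Fintype.sum_bool, add_comm]

lemma setOverlap_nonneg {n : ℕ} (T : Finset (Fin n → Bool)) {u : Fin n → Bool → ℝ}
    (hu : IsNonnegUnit u) : 0 ≤ setOverlap T u :=
  mul_nonneg (by positivity) (Finset.sum_nonneg fun x _ => amplitude_nonneg hu x)

lemma setOverlap_sq_le {n : ℕ} (T : Finset (Fin n → Bool)) (u : Fin n → Bool → ℝ) :
    setOverlap T u ^ 2 ≤ ∑ x ∈ T, amplitude u x ^ 2 := by
  rcases T.eq_empty_or_nonempty with rfl | hT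
  · simp [setOverlap]
  have hc : (0 : ℝ) < T.card := by exact_mod_cast hT.card_pos
  rw [setOverlap, mul_pow, div_pow, Real.sq_sqrt hc.le, one_pow, one_div,
    inv_mul_le_iff₀ hc]
  exact sq_sum_le_card_mul_sum_sq

lemma setOverlap_le_one {n : ℕ} (T : Finset (Fin n → Bool)) {u : Fin n → Bool → ℝ}
    (hu : IsNonnegUnit u) : setOverlap T u ≤ 1 := by
  have h : ∑ x ∈ T, amplitude u x ^ 2 ≤ 1 := by
    calc ∑ x ∈ T, amplitude u x ^ 2 ≤ ∑ x, amplitude u x ^ 2 :=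
          Finset.sum_le_sum_of_subset_of_nonneg (Finset.subset_univ _)
            fun _ _ _ => sq_nonneg _
      _ = 1 := by
          rw [sum_amplitude_pow]
          exact Finset.prod_eq_one fun s _ => hu.norm_eq s
  have h2 := (setOverlap_sq_le T u).trans h
  nlinarith [setOverlap_nonneg T hu]

/-- Cauchy–Schwarz twice; once extended to all strings, the sum of fourth powers factorises over the
qubits. -/
lemma setOverlap_pow_four_le {n : ℕ} (T : Finset (Fin n → Bool)) (u : Fin n → Bool → ℝ) :
    setOverlap T u ^ 4 ≤ T.card * ∏ s, (u s false ^ 4 + u s true ^ 4) := by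
  calc setOverlap T u ^ 4 = (setOverlap T u ^ 2) ^ 2 := by ring
    _ ≤ (∑ x ∈ T, amplitude u x ^ 2) ^ 2 :=
        pow_le_pow_left₀ (sq_nonneg _) (setOverlap_sq_le T u) 2
    _ ≤ T.card * ∑ x ∈ T, (amplitude u x ^ 2) ^ 2 := sq_sum_le_card_mul_sum_sq
    _ = T.card * ∑ x ∈ T, amplitude u x ^ 4 := by simp only [← pow_mul]
    _ ≤ T.card * ∑ x, amplitude u x ^ 4 := by
        refine mul_le_mul_of_nonneg_left ?_ (Nat.cast_nonneg _)
        exact Finset.sum_le_sum_of_subset_of_nonneg (Finset.subset_univ _)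
          fun x _ _ => Even.pow_nonneg (by decide) _
    _ = _ := by rw [sum_amplitude_pow]

lemma card_univ_strings (n : ℕ) :
    ((Finset.univ : Finset (Fin n → Bool)).card : ℝ) = 2 ^ n := by
  simp

/-- With y = (a + b)²/2 the claim is y⁴(1 + 4y - 4y²) ≤ 1. The exponents put the maximum at the
balanced qubit y = 1, hence the double root there. -/
lemma add_pow_eight_mul_le {a b : ℝ} (h : a ^ 2 + b ^ 2 = 1) :
    (a + b) ^ 8 * (a ^ 4 + b ^ 4) ≤ 8 := by
  obtain ⟨y, hy⟩ : ∃ y, y = (1 + 2 * (a * b)) / 2 := ⟨_, rfl⟩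
  have h1 : (a + b) ^ 2 = 2 * y := by rw [hy]; linear_combination h
  have h2 : a ^ 4 + b ^ 4 = (1 + 4 * y - 4 * y ^ 2) / 2 := by
    rw [hy]; linear_combination (a ^ 2 + b ^ 2 + 1) * h
  have hy0 : 0 ≤ y := by nlinarith [sq_nonneg (a + b)]
  have h3 : (a + b) ^ 8 = 16 * y ^ 4 := by
    calc (a + b) ^ 8 = ((a + b) ^ 2) ^ 4 := by ring
      _ = _ := by rw [h1]; ring
  rw [h2, h3]
  have h4 : 0 ≤ (y - 1) ^ 2 * (4 * y ^ 4 + 4 * y ^ 3 + 3 * y ^ 2 + 2 * y + 1) := by positivity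
  nlinarith [h4]

/-- A product vector cannot overlap both with the uniform state and with a uniform superposition
over a small set. -/
lemma univ_overlap_mul_setOverlap_le {n : ℕ} (T : Finset (Fin n → Bool))
    {u : Fin n → Bool → ℝ} (hu : IsNonnegUnit u) :
    setOverlap Finset.univ u ^ 8 * setOverlap T u ^ 4 ≤ T.card / 2 ^ n := by
  have hA : setOverlap Finset.univ u ^ 8 = (∏ s, (u s false + u s true) ^ 8) / (2 ^ n) ^ 4 := by
    have h1 := sum_amplitude_pow u 1
    simp only [pow_one] at h1
    rw [setOverlap, h1, card_univ_strings, mul_pow, div_pow, Finset.prod_pow]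
    have : Real.sqrt (2 ^ n) ^ 8 = (2 ^ n) ^ 4 := by
      rw [show 8 = 2 * 4 from rfl, pow_mul, Real.sq_sqrt (by positivity)]
    rw [this]; ring
  -- The bound 8 per qubit gives N³ against the normalisation N⁴ in `hA`, which leaves M/N.
  have hP : (∏ s, (u s false + u s true) ^ 8) * ∏ s, (u s false ^ 4 + u s true ^ 4)
      ≤ (2 ^ n) ^ 3 := by
    rw [← Finset.prod_mul_distrib]
    calc _ ≤ ∏ _s : Fin n, (8 : ℝ) := by
          refine Finset.prod_le_prod (fun s _ => ?_) fun s _ => add_pow_eight_mul_le (hu.norm_eq s)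
          positivity
      _ = (2 ^ n) ^ 3 := by
          rw [Finset.prod_const, Finset.card_univ, Fintype.card_fin, ← pow_mul, mul_comm, pow_mul]
          norm_num
  have hB := setOverlap_pow_four_le T u
  have hA0 : 0 ≤ ∏ s, (u s false + u s true) ^ 8 :=
    Finset.prod_nonneg fun s _ => Even.pow_nonneg (by decide) _
  have hN : (0 : ℝ) < 2 ^ n := by positivity
  have hT : (0 : ℝ) ≤ T.card := Nat.cast_nonneg _
  rw [hA]
  generalize (2 : ℝ) ^ n = N at *
  generalize (∏ s, (u s false + u s true) ^ 8) = A at *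
  generalize (∏ s, (u s false ^ 4 + u s true ^ 4)) = D at *
  generalize setOverlap T u ^ 4 = B at *
  generalize (T.card : ℝ) = M at *
  rw [div_mul_eq_mul_div, div_le_div_iff₀ (by positivity) hN]
  have h2 := mul_le_mul_of_nonneg_left hB hA0
  have h3 := mul_le_mul_of_nonneg_left hP hT
  have h1 : A * B ≤ M * N ^ 3 := by linarith
  nlinarith [mul_le_mul_of_nonneg_right h1 hN.le]

/-! ### The largest overlap with a symmetric superposition -/

/-- The real qubit `cos a |0⟩ + sin a |1⟩`. -/
noncomputable def qubit (a : ℝ) (y : Bool) : ℝ := if y then Real.sin a else Real.cos a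

lemma continuous_qubit (y : Bool) : Continuous fun a => qubit a y := by
  cases y
  · simpa [qubit] using Real.continuous_cos
  · simpa [qubit] using Real.continuous_sin

lemma isNonnegUnit_qubit {n : ℕ} {a : Fin n → ℝ} (ha : a ∈ Set.Icc 0 fun _ => Real.pi / 2) :
    IsNonnegUnit fun s => qubit (a s) := by
  refine ⟨fun s y => ?_, fun s => by simp [qubit]⟩
  have h0 : 0 ≤ a s := ha.1 s
  have h1 : a s ≤ Real.pi / 2 := ha.2 s
  cases y
  · simpa [qubit] using Real.cos_nonneg_of_mem_Icc ⟨by linarith, h1⟩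
  · simpa [qubit] using Real.sin_nonneg_of_nonneg_of_le_pi h0 (by linarith [Real.pi_pos])

lemma IsNonnegUnit.exists_eq_qubit {n : ℕ} {u : Fin n → Bool → ℝ} (hu : IsNonnegUnit u) :
    ∃ a ∈ Set.Icc (0 : Fin n → ℝ) fun _ => Real.pi / 2, u = fun s => qubit (a s) := by
  refine ⟨fun s => Real.arccos (u s false), ⟨fun s => Real.arccos_nonneg _, fun s => ?_⟩, ?_⟩
  · exact Real.arccos_le_pi_div_two.2 (hu.nonneg s _)
  · funext s y
    have h0 := hu.nonneg s false
    have h1 := hu.nonneg s true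
    have h2 := hu.norm_eq s
    cases y
    · simp only [qubit]
      rw [if_neg (by simp), Real.cos_arccos (by linarith) (by nlinarith)]
    · simp only [qubit, if_true]
      rw [Real.sin_arccos, ← Real.sqrt_sq h1]
      congr 1
      linarith

/-- With mean m and half-difference d: cos a cos b = cos² m - sin² d, sin a sin b = sin² m - sin² d,
and the mixed case is the identity sin(a + b) = 2 sin m cos m. -/
lemma qubit_mul_add_mul_le (a b : ℝ) (y z : Bool) :
    qubit a y * qubit b z + qubit b y * qubit a z
      ≤ 2 * (qubit ((a + b) / 2) y * qubit ((a + b) / 2) z) := by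
  obtain ⟨m, d, rfl, rfl⟩ : ∃ m d, a = m + d ∧ b = m - d :=
    ⟨(a + b) / 2, (a - b) / 2, by ring, by ring⟩
  rw [show (m + d + (m - d)) / 2 = m by ring]
  have hm := Real.sin_sq_add_cos_sq m
  have hd := Real.sin_sq_add_cos_sq d
  have h1 := sq_nonneg (Real.sin d)
  cases y <;> cases z <;>
    simp only [qubit, if_true, Bool.false_eq_true, if_false, Real.cos_add, Real.cos_sub,
      Real.sin_add, Real.sin_sub]
  · nlinarith
  · exact le_of_eq (by linear_combination 2 * Real.sin m * Real.cos m * hd)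
  · exact le_of_eq (by linear_combination 2 * Real.sin m * Real.cos m * hd)
  · nlinarith

lemma amplitude_comp {n : ℕ} (u : Fin n → Bool → ℝ) (σ : Equiv.Perm (Fin n))
    (x : Fin n → Bool) : amplitude (u ∘ σ) (x ∘ σ) = amplitude u x :=
  Equiv.prod_comp σ fun s => u s (x s)

lemma sum_amplitude_comp {n : ℕ} {T : Finset (Fin n → Bool)}
    (hT : ∀ (σ : Equiv.Perm (Fin n)) x, x ∘ σ ∈ T ↔ x ∈ T) (u : Fin n → Bool → ℝ)
    (σ : Equiv.Perm (Fin n)) : ∑ x ∈ T, amplitude (u ∘ σ) x = ∑ x ∈ T, amplitude u x := by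
  symm
  refine Finset.sum_bij' (fun x _ => x ∘ σ) (fun x _ => x ∘ σ.symm) (fun x hx => (hT σ x).2 hx)
    (fun x hx => (hT σ.symm x).2 hx) (fun x _ => ?_) (fun x _ => ?_)
    (fun x _ => (amplitude_comp u σ x).symm)
  · funext s; simp
  · funext s; simp

/-- Replacing two angles by their mean does not decrease the overlap. -/
lemma sum_amplitude_qubit_le_mean {n : ℕ} {T : Finset (Fin n → Bool)}
    (hT : ∀ (σ : Equiv.Perm (Fin n)) x, x ∘ σ ∈ T ↔ x ∈ T) {a b : Fin n → ℝ}
    (ha : a ∈ Set.Icc 0 fun _ => Real.pi / 2) {i j : Fin n} (hij : i ≠ j)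
    (hi : b i = (a i + a j) / 2) (hj : b j = (a i + a j) / 2)
    (hb : ∀ s, s ≠ i → s ≠ j → b s = a s) :
    ∑ x ∈ T, amplitude (fun s => qubit (a s)) x ≤ ∑ x ∈ T, amplitude (fun s => qubit (b s)) x := by
  -- Swapping the two qubits leaves the total unchanged, so the original and swapped amplitudes
  -- together can be compared with twice the averaged one, string by string.
  have hswap := sum_amplitude_comp hT (fun s => qubit (a s)) (Equiv.swap i j)
  suffices h : ∑ x ∈ T, (amplitude (fun s => qubit (a s)) x +
      amplitude ((fun s => qubit (a s)) ∘ Equiv.swap i j) x)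
      ≤ ∑ x ∈ T, 2 * amplitude (fun s => qubit (b s)) x by
    rw [Finset.sum_add_distrib, hswap, ← Finset.mul_sum] at h
    linarith
  refine Finset.sum_le_sum fun x _ => ?_
  have split : ∀ v : Fin n → Bool → ℝ, amplitude v x =
      v i (x i) * (v j (x j) * ∏ s ∈ (Finset.univ.erase i).erase j, v s (x s)) := by
    intro v
    rw [amplitude, ← Finset.mul_prod_erase _ _ (Finset.mem_univ i), ← Finset.mul_prod_erase
      (Finset.univ.erase i) _ (Finset.mem_erase.2 ⟨hij.symm, Finset.mem_univ j⟩)]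
  have hne : ∀ s ∈ (Finset.univ.erase i).erase j, s ≠ i ∧ s ≠ j := fun s hs => by
    simp only [Finset.mem_erase, Finset.mem_univ, and_true] at hs
    exact ⟨hs.2, hs.1⟩
  have e1 : ∏ s ∈ (Finset.univ.erase i).erase j,
      ((fun s => qubit (a s)) ∘ Equiv.swap i j) s (x s)
      = ∏ s ∈ (Finset.univ.erase i).erase j, qubit (a s) (x s) :=
    Finset.prod_congr rfl fun s hs => by
      simp [Equiv.swap_apply_of_ne_of_ne (hne s hs).1 (hne s hs).2]
  have e2 : ∏ s ∈ (Finset.univ.erase i).erase j, qubit (b s) (x s)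
      = ∏ s ∈ (Finset.univ.erase i).erase j, qubit (a s) (x s) :=
    Finset.prod_congr rfl fun s hs => by rw [hb s (hne s hs).1 (hne s hs).2]
  have hnn : 0 ≤ ∏ s ∈ (Finset.univ.erase i).erase j, qubit (a s) (x s) :=
    Finset.prod_nonneg fun s _ => (isNonnegUnit_qubit ha).nonneg s _
  rw [split, split ((fun s => qubit (a s)) ∘ Equiv.swap i j), split fun s => qubit (b s), e1, e2]
  simp only [Function.comp_apply, Equiv.swap_apply_left, Equiv.swap_apply_right, hi, hj]
  nlinarith [mul_le_mul_of_nonneg_right (qubit_mul_add_mul_le (a i) (a j) (x i) (x j)) hnn]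

/-- For a permutation-invariant set, equal angles give the largest overlap. -/
lemma sum_amplitude_qubit_le {n : ℕ} {T : Finset (Fin n → Bool)}
    (hT : ∀ (σ : Equiv.Perm (Fin n)) x, x ∘ σ ∈ T ↔ x ∈ T) {c : ℝ}
    (hc : ∀ m ∈ Set.Icc 0 (Real.pi / 2), ∑ x ∈ T, amplitude (fun _ => qubit m) x ≤ c)
    {a : Fin n → ℝ} (ha : a ∈ Set.Icc 0 fun _ => Real.pi / 2) :
    ∑ x ∈ T, amplitude (fun s => qubit (a s)) x ≤ c := by
  have hcont : Continuous fun a : Fin n → ℝ => ∑ x ∈ T, amplitude (fun s => qubit (a s)) x :=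
    continuous_finsetSum _ fun x _ => continuous_finsetProd _ fun s _ =>
      (continuous_qubit (x s)).comp (continuous_apply s)
  -- Averaging need not increase the overlap strictly. The penalty on squared angles makes it
  -- strict, so a maximiser on the compact cube has all angles equal; ε then tends to 0.
  have key : ∀ ε > 0, ∑ x ∈ T, amplitude (fun s => qubit (a s)) x ≤ c + ε * ∑ s, a s ^ 2 := by
    intro ε hε
    obtain ⟨b, hb, hmax⟩ := (isCompact_Icc (a := (0 : Fin n → ℝ))
      (b := fun _ => Real.pi / 2)).exists_isMaxOn ⟨a, ha⟩
      (f := fun a => ∑ x ∈ T, amplitude (fun s => qubit (a s)) x - ε * ∑ s, a s ^ 2)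
      (hcont.sub (by fun_prop)).continuousOn
    have heq : ∀ i j, b i = b j := by
      intro i j
      by_contra hne
      have hij : i ≠ j := fun h => hne (by rw [h])
      set b' : Fin n → ℝ := fun s => if s = i ∨ s = j then (b i + b j) / 2 else b s with hb'
      have hb'mem : b' ∈ Set.Icc (0 : Fin n → ℝ) fun _ => Real.pi / 2 := by
        have l := hb.1
        have r := hb.2
        constructor <;> intro s <;> simp only [hb'] <;> split_ifs
        · have := l i; have := l j; simp only [Pi.zero_apply] at *; linarith
        · exact l s
        · have := r i; have := r j; simp only at *; linarith
        · exact r s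
      have h1 := hmax hb'mem
      have h2 := sum_amplitude_qubit_le_mean hT (b := b') hb hij (by simp [hb']) (by simp [hb'])
        (fun s h h' => by simp [hb', h, h'])
      have hsum : ∑ s, b s ^ 2 - ∑ s, b' s ^ 2 = (b i - b j) ^ 2 / 2 := by
        rw [← Finset.sum_sub_distrib,
          ← Finset.sum_subset (Finset.subset_univ {i, j}) fun s _ hs => ?_,
          Finset.sum_pair hij]
        · simp only [hb', true_or, or_true, if_true]
          ring
        · simp only [Finset.mem_insert, Finset.mem_singleton] at hs
          simp [hb', hs]
      have h3 : 0 < (b i - b j) ^ 2 := by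
        have := sub_ne_zero.2 hne
        positivity
      simp only [Set.mem_ofPred_eq] at h1
      nlinarith
    have hbc : ∑ x ∈ T, amplitude (fun s => qubit (b s)) x ≤ c := by
      rcases n.eq_zero_or_pos with rfl | hn
      · have : (fun s : Fin 0 => qubit (b s)) = fun _ => qubit 0 := funext fun s => s.elim0
        rw [this]
        exact hc 0 ⟨le_rfl, by positivity⟩
      · have : (fun s => qubit (b s)) = fun _ => qubit (b ⟨0, hn⟩) :=
          funext fun s => by rw [heq s ⟨0, hn⟩]
        rw [this]
        exact hc _ ⟨hb.1 _, hb.2 _⟩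
    have h1 := hmax ha
    simp only [Set.mem_ofPred_eq] at h1
    have h2 : 0 ≤ ε * ∑ s, b s ^ 2 := mul_nonneg hε.le (Finset.sum_nonneg fun s _ => sq_nonneg _)
    linarith
  refine le_of_forall_pos_le_add fun ε hε => ?_
  have hD : 0 ≤ ∑ s, a s ^ 2 := Finset.sum_nonneg fun s _ => sq_nonneg _
  refine (key (ε / (∑ s, a s ^ 2 + 1)) (by positivity)).trans ?_
  gcongr
  rw [div_mul_eq_mul_div, div_le_iff₀ (by positivity)]
  nlinarith

namespace SearchProblem

lemma marked_comp_iff {P : SearchProblem} (hne : P.marked.Nonempty)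
    (hs : IsSymmetricState P.solutionState) (σ : Equiv.Perm (Fin P.n)) (x : Fin P.n → Bool) :
    x ∘ σ ∈ P.marked ↔ x ∈ P.marked := by
  have hM : (1 / Real.sqrt P.M : ℝ) ≠ 0 := by
    have : (0 : ℝ) < P.M := Nat.cast_pos.2 hne.card_pos
    positivity
  have hM' : ((1 / Real.sqrt P.M : ℝ) : ℂ) ≠ 0 := by exact_mod_cast hM
  have h := hs σ x
  simp only [solutionState] at h
  by_cases h1 : x ∘ σ ∈ P.marked <;> by_cases h2 : x ∈ P.marked <;>
    simp only [h1, h2, if_true, if_false] at h ⊢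
  · exact (hM' h).elim
  · exact (hM' h.symm).elim

lemma B_eq_setOverlap (P : SearchProblem) (α : ℝ) :
    P.B α = setOverlap P.marked fun _ => qubit (α / 2) := by
  rw [B, setOverlap, M]
  congr 1
  refine Finset.sum_congr rfl fun x _ => ?_
  have h := Finset.prod_ite (s := (Finset.univ : Finset (Fin P.n))) (p := fun i => x i = true)
    (fun _ => Real.sin (α / 2)) (fun _ => Real.cos (α / 2))
  simp only [amplitude, qubit]
  rw [h, Finset.prod_const, Finset.prod_const, mul_comm, hammingWeight]
  congr 2
  have := Finset.card_filter_add_card_filter_not (s := (Finset.univ : Finset (Fin P.n)))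
    (fun i => x i = true)
  rw [Finset.card_univ, Fintype.card_fin] at this
  omega

lemma exists_B_eq_BMax (P : SearchProblem) :
    (∃ α ∈ Set.Icc 0 Real.pi, P.B α = P.BMax) ∧ ∀ α ∈ Set.Icc 0 Real.pi, P.B α ≤ P.BMax := by
  have hc : Continuous P.B := by unfold B; fun_prop
  have hk : IsCompact (P.B '' Set.Icc 0 Real.pi) := isCompact_Icc.image hc
  refine ⟨?_, fun α hα => le_csSup hk.bddAbove ⟨α, hα, rfl⟩⟩
  exact hk.sSup_mem ⟨_, ⟨0, ⟨le_rfl, Real.pi_pos.le⟩, rfl⟩⟩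

lemma setOverlap_marked_le_BMax {P : SearchProblem} (hne : P.marked.Nonempty)
    (hs : IsSymmetricState P.solutionState) {u : Fin P.n → Bool → ℝ} (hu : IsNonnegUnit u) :
    setOverlap P.marked u ≤ P.BMax := by
  obtain ⟨a, ha, rfl⟩ := hu.exists_eq_qubit
  have hM : (0 : ℝ) < P.marked.card := by exact_mod_cast hne.card_pos
  have hM' := Real.sqrt_pos.2 hM
  rw [setOverlap, one_div, inv_mul_le_iff₀ hM']
  refine sum_amplitude_qubit_le (marked_comp_iff hne hs) (fun m hm => ?_) ha
  have h := P.exists_B_eq_BMax.2 (2 * m) ⟨by linarith [hm.1], by linarith [hm.2]⟩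
  rwa [B_eq_setOverlap, show 2 * m / 2 = m by ring, setOverlap, one_div,
    inv_mul_le_iff₀ hM'] at h

lemma exists_setOverlap_eq_BMax (P : SearchProblem) :
    ∃ u : Fin P.n → Bool → ℝ, IsNonnegUnit u ∧ setOverlap P.marked u = P.BMax := by
  obtain ⟨α, hα, h⟩ := P.exists_B_eq_BMax.1
  refine ⟨fun _ => qubit (α / 2), isNonnegUnit_qubit ⟨fun _ => ?_, fun _ => ?_⟩, ?_⟩
  · have := hα.1
    simp only [Pi.zero_apply]
    linarith
  · have := hα.2
    simp only
    linarith
  · rw [← B_eq_setOverlap, h]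

end SearchProblem

/-! ### Complex product states -/

/-- The overlap of a state with the uniform superposition over `T`. -/
noncomputable def stateOverlap {n : ℕ} (T : Finset (Fin n → Bool)) (v : QState n) : ℂ :=
  ((1 / Real.sqrt (T.card : ℝ) : ℝ) : ℂ) * ∑ x ∈ T, v x

lemma inner_uniformState {n : ℕ} (v : QState n) :
    inner ℂ (uniformState n) v = stateOverlap Finset.univ v := by
  rw [stateOverlap, card_univ_strings, PiLp.inner_apply, Finset.mul_sum]
  refine Finset.sum_congr rfl fun x _ => ?_
  simp only [uniformState, RCLike.inner_apply, Complex.conj_ofReal]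
  ring

lemma SearchProblem.inner_solutionState (P : SearchProblem) (v : QState P.n) :
    inner ℂ P.solutionState v = stateOverlap P.marked v := by
  rw [stateOverlap, PiLp.inner_apply, Finset.mul_sum, ← Finset.sum_filter_add_sum_filter_not
    Finset.univ (· ∈ P.marked), Finset.filter_mem_eq_inter, Finset.univ_inter,
    Finset.sum_eq_zero (s := Finset.univ.filter (· ∉ P.marked)), add_zero]
  · refine Finset.sum_congr rfl fun x hx => ?_
    simp only [SearchProblem.solutionState, RCLike.inner_apply, hx, if_true, Complex.conj_ofReal,
      SearchProblem.M]
    ring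
  · intro x hx
    simp [SearchProblem.solutionState, (Finset.mem_filter.1 hx).2]

lemma isNonnegUnit_norm {n : ℕ} {φ : Fin n → EuclideanSpace ℂ Bool} (hφ : ∀ s, ‖φ s‖ = 1) :
    IsNonnegUnit fun s y => ‖φ s y‖ := by
  refine ⟨fun s y => norm_nonneg _, fun s => ?_⟩
  have h := EuclideanSpace.norm_sq_eq (φ s)
  rw [hφ s, Fintype.sum_bool] at h
  linarith

/-- The triangle inequality: phases never help, so nonnegative real qubits suffice. -/
lemma norm_stateOverlap_productState_le {n : ℕ} (T : Finset (Fin n → Bool))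
    (φ : Fin n → EuclideanSpace ℂ Bool) :
    ‖stateOverlap T (productState φ)‖ ≤ setOverlap T fun s y => ‖φ s y‖ := by
  rw [stateOverlap, setOverlap, norm_mul, Complex.norm_real, Real.norm_of_nonneg (by positivity)]
  refine mul_le_mul_of_nonneg_left ((norm_sum_le _ _).trans ?_) (by positivity)
  refine Finset.sum_le_sum fun x _ => ?_
  simp [productState, amplitude, norm_prod]

/-- Real single-qubit vectors, as complex ones. -/
noncomputable def realQubits {n : ℕ} (u : Fin n → Bool → ℝ) : Fin n → EuclideanSpace ℂ Bool :=
  fun s => WithLp.toLp 2 fun y => (u s y : ℂ)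

lemma norm_realQubits {n : ℕ} {u : Fin n → Bool → ℝ} (hu : IsNonnegUnit u) (s : Fin n) :
    ‖realQubits u s‖ = 1 := by
  rw [EuclideanSpace.norm_eq, Real.sqrt_eq_one, Fintype.sum_bool]
  simp only [realQubits, Complex.norm_real, Real.norm_eq_abs, sq_abs]
  linarith [hu.norm_eq s]

lemma stateOverlap_realQubits {n : ℕ} (T : Finset (Fin n → Bool)) (u : Fin n → Bool → ℝ) :
    stateOverlap T (productState (realQubits u)) = setOverlap T u := by
  simp [stateOverlap, setOverlap, productState, realQubits, amplitude]

namespace SearchProblem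

variable {P : SearchProblem}

lemma M_pos (hne : P.marked.Nonempty) : 0 < P.M := Nat.cast_pos.2 hne.card_pos

lemma N_pos : 0 < P.N := by unfold N; positivity

lemma M_le_N : P.M ≤ P.N := by
  rw [M, N, ← card_univ_strings]
  exact_mod_cast Finset.card_le_univ P.marked

lemma sin_angle : Real.sin P.angle = Real.sqrt (P.M / P.N) :=
  Real.sin_arcsin (by linarith [Real.sqrt_nonneg (P.M / P.N)])
    (Real.sqrt_le_one.2 ((div_le_one N_pos).2 M_le_N))

/-! ### The iterates of Grover's algorithm -/

lemma stateOverlap_univ_uniformState (n : ℕ) :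
    stateOverlap Finset.univ (uniformState n) = 1 := by
  have h : (0 : ℝ) < 2 ^ n := by positivity
  simp only [stateOverlap, uniformState, card_univ_strings, Finset.sum_const, nsmul_eq_mul]
  rw [← Complex.ofReal_natCast, card_univ_strings]
  norm_cast
  have := Real.sq_sqrt h.le
  field_simp
  exact_mod_cast this.symm

lemma stateOverlap_univ_solutionState :
    stateOverlap Finset.univ P.solutionState = (Real.sin P.angle : ℝ) := by
  have h : (0 : ℝ) ≤ P.M := Nat.cast_nonneg _
  simp only [stateOverlap, solutionState, card_univ_strings, Finset.sum_ite_mem,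
    Finset.univ_inter, Finset.sum_const, nsmul_eq_mul]
  rw [← Complex.ofReal_natCast, sin_angle, Real.sqrt_div h, N]
  norm_cast
  rw [← M]
  have := Real.div_sqrt (x := P.M)
  rw [mul_one_div, this]
  ring

/-- On marked strings |ψ₀⟩ agrees with sin θ |S₁⟩, so the oracle sends |ψ₀⟩ to |ψ₀⟩ - 2 sin θ |S₁⟩;
the reflection uses ⟨ψ₀|S₁⟩ = sin θ. -/
lemma groverStep_apply (p q : ℝ) (hne : P.marked.Nonempty) :
    P.groverStep ((p : ℂ) • uniformState P.n + (q : ℂ) • P.solutionState) =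
      (((1 - 4 * Real.sin P.angle ^ 2) * p - 2 * Real.sin P.angle * q : ℝ) : ℂ) •
        uniformState P.n +
      ((2 * Real.sin P.angle * p + q : ℝ) : ℂ) • P.solutionState := by
  have hO : P.oracle ((p : ℂ) • uniformState P.n + (q : ℂ) • P.solutionState) =
      (p : ℂ) • uniformState P.n - ((2 * Real.sin P.angle * p + q : ℝ) : ℂ) • P.solutionState := by
    ext x
    have hM := Real.sqrt_pos.2 (M_pos hne)
    have hN := Real.sqrt_pos.2 (N_pos (P := P))
    have hs : Real.sin P.angle * (1 / Real.sqrt P.M) = 1 / Real.sqrt (2 ^ P.n) := by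
      rw [sin_angle, Real.sqrt_div (M_pos hne).le, ← N]
      field_simp
    by_cases hx : x ∈ P.marked
    · simp only [oracle, hx, if_true, PiLp.add_apply, PiLp.sub_apply, PiLp.smul_apply, smul_eq_mul,
        uniformState, solutionState]
      norm_cast
      push_cast
      linear_combination (2 * p) * hs
    · simp [oracle, hx, solutionState, uniformState]
  rw [groverStep, hO, inner_sub_right, inner_smul_right, inner_smul_right, inner_uniformState,
    inner_uniformState, stateOverlap_univ_uniformState, stateOverlap_univ_solutionState]
  ext x
  simp only [PiLp.add_apply, PiLp.sub_apply, PiLp.smul_apply, smul_eq_mul]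
  push_cast
  ring

/-- The usual rotation, written in the non-orthogonal basis |ψ₀⟩, |S₁⟩ because the product overlaps
of these two vectors are the ones under control. -/
lemma stateAfter_eq (hne : P.marked.Nonempty) (hc : Real.cos P.angle ≠ 0) (k : ℕ) :
    P.stateAfter k =
      ((Real.cos (2 * k * P.angle + P.angle) / Real.cos P.angle : ℝ) : ℂ) • uniformState P.n +
      ((Real.sin (2 * k * P.angle) / Real.cos P.angle : ℝ) : ℂ) • P.solutionState := by
  induction k with
  | zero => simp [stateAfter, hc]
  | succ k ih =>
    have hstep : P.stateAfter (k + 1) = P.groverStep (P.stateAfter k) :=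
      Function.iterate_succ_apply' _ _ _
    rw [hstep, ih, groverStep_apply _ _ hne]
    have e1 : 2 * ((k + 1 : ℕ) : ℝ) * P.angle = 2 * k * P.angle + P.angle + P.angle := by
      push_cast; ring
    rw [e1]
    generalize 2 * (k : ℝ) * P.angle = t
    have h1 := Real.sin_sq_add_cos_sq P.angle
    generalize P.angle = θ at *
    congr 3
    · field_simp
      simp only [Real.cos_add, Real.sin_add]
      linear_combination (-(Real.cos t * Real.cos θ) + 3 * Real.sin t * Real.sin θ) * h1
    · field_simp
      simp only [Real.cos_add, Real.sin_add]
      linear_combination (- Real.sin t) * h1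

lemma inner_stateAfter (hne : P.marked.Nonempty) (hc : Real.cos P.angle ≠ 0) (k : ℕ)
    (v : QState P.n) :
    inner ℂ (P.stateAfter k) v =
      ((Real.cos (2 * k * P.angle + P.angle) / Real.cos P.angle : ℝ) : ℂ) *
        stateOverlap Finset.univ v +
      ((Real.sin (2 * k * P.angle) / Real.cos P.angle : ℝ) : ℂ) * stateOverlap P.marked v := by
  rw [stateAfter_eq hne hc, inner_add_left, inner_smul_left, inner_smul_left, inner_uniformState,
    inner_solutionState, Complex.conj_ofReal, Complex.conj_ofReal]

end SearchProblem

/-! ### Asymptotics of the entanglement -/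

/-- The limiting maximal overlap at rotation angle `t`, if the solution state has maximal
overlap `b` with product states. -/
noncomputable def limitOverlap (b t : ℝ) : ℝ := max |Real.cos t| (|Real.sin t| * b)

lemma limitOverlap_nonneg (b t : ℝ) : 0 ≤ limitOverlap b t :=
  (abs_nonneg _).trans (le_max_left _ _)

lemma limitOverlap_le (b t : ℝ) : limitOverlap b t ≤ 1 + |b| := by
  refine max_le ?_ ?_
  · linarith [Real.abs_cos_le_one t, abs_nonneg b]
  · nlinarith [Real.abs_sin_le_one t, abs_nonneg (Real.sin t), abs_nonneg b, le_abs_self b]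

lemma limitOverlap_le_one {b : ℝ} (hb : b ≤ 1) (t : ℝ) : limitOverlap b t ≤ 1 :=
  max_le (Real.abs_cos_le_one t)
    (by nlinarith [Real.abs_sin_le_one t, abs_nonneg (Real.sin t)])

lemma abs_limitOverlap_sub_le {b : ℝ} (hb0 : 0 ≤ b) (hb : b ≤ 1) (c t t' : ℝ) :
    |limitOverlap b t - limitOverlap c t'| ≤ |t - t'| + |b - c| := by
  refine (abs_max_sub_max_le_max _ _ _ _).trans (max_le ?_ ?_)
  · have h1 : |Real.cos t - Real.cos t'| ≤ |t - t'| := by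
      simpa using Real.abs_cos_sub_cos_le t t'
    linarith [abs_abs_sub_abs_le (Real.cos t) (Real.cos t'), abs_nonneg (b - c)]
  · have h1 : |Real.sin t - Real.sin t'| ≤ |t - t'| := by
      simpa using Real.abs_sin_sub_sin_le t t'
    have h2 := abs_abs_sub_abs_le (Real.sin t) (Real.sin t')
    have h3 : |Real.sin t| * b - |Real.sin t'| * c =
      (|Real.sin t| - |Real.sin t'|) * b + |Real.sin t'| * (b - c) := by ring
    rw [h3]
    refine (abs_add_le _ _).trans (add_le_add ?_ ?_)
    · rw [abs_mul, abs_of_nonneg hb0]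
      nlinarith [abs_nonneg (|Real.sin t| - |Real.sin t'|)]
    · rw [abs_mul, abs_abs]
      nlinarith [Real.abs_sin_le_one t', abs_nonneg (b - c)]

lemma abs_limitOverlap_sq_sub_le {b : ℝ} (hb0 : 0 ≤ b) (hb : b ≤ 1) (c t t' : ℝ) :
    |limitOverlap b t ^ 2 - limitOverlap c t' ^ 2| ≤ (2 + |c|) * (|t - t'| + |b - c|) := by
  have h1 := abs_limitOverlap_sub_le hb0 hb c t t'
  have h2 := limitOverlap_le_one hb t
  have h3 := limitOverlap_le c t'
  have h4 := limitOverlap_nonneg b t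
  have h5 := limitOverlap_nonneg c t'
  rw [sq_sub_sq, abs_mul]
  refine mul_le_mul ?_ h1 (abs_nonneg _) (by positivity)
  rw [abs_of_nonneg (by positivity)]
  linarith

/-! ### Two-sided estimate of the largest overlap -/

/-- The qubits `(|0⟩ + |1⟩) / √2`. -/
noncomputable def balanced (n : ℕ) : Fin n → Bool → ℝ := fun _ _ => 1 / Real.sqrt 2

lemma isNonnegUnit_balanced (n : ℕ) : IsNonnegUnit (balanced n) := by
  refine ⟨fun _ _ => by unfold balanced; positivity, fun _ => ?_⟩
  simp only [balanced, div_pow, Real.sq_sqrt (by norm_num : (0 : ℝ) ≤ 2)]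
  norm_num

lemma setOverlap_balanced {n : ℕ} (T : Finset (Fin n → Bool)) :
    setOverlap T (balanced n) = Real.sqrt T.card / Real.sqrt (2 ^ n) := by
  have h : Real.sqrt 2 ^ n = Real.sqrt (2 ^ n) := by
    rw [Real.sqrt_eq_rpow, Real.sqrt_eq_rpow, Real.rpow_pow_comm (by norm_num)]
  simp only [setOverlap, amplitude, balanced, Finset.prod_const, Finset.card_univ,
    Fintype.card_fin, Finset.sum_const, nsmul_eq_mul, div_pow, one_pow, h]
  rw [← mul_assoc, one_div_mul_eq_div, Real.div_sqrt, mul_one_div]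

/-- If A and B both exceeded ε, then A⁸B⁴ > ε¹²; so one of the two terms is negligible. -/
lemma overlap_upper {A B b p q c s ε δ : ℝ} (hε : 0 < ε) (hA0 : 0 ≤ A) (hA : A ≤ 1) (hB0 : 0 ≤ B)
    (hBb : B ≤ b) (hb : b ≤ 1) (hAB : A ^ 8 * B ^ 4 ≤ ε ^ 12) (hp : |p - c| ≤ δ)
    (hq : |q - s| ≤ δ) (hc : |c| ≤ 1) (hs : |s| ≤ 1) :
    |p| * A + |q| * B ≤ max |c| (|s| * b) + ε + 2 * δ := by
  have hp' : |p| ≤ |c| + δ := by linarith [abs_sub_abs_le_abs_sub p c]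
  have hq' : |q| ≤ |s| + δ := by linarith [abs_sub_abs_le_abs_sub q s]
  have hδ : 0 ≤ δ := (abs_nonneg _).trans hp
  have hc0 := abs_nonneg c
  have hs0 := abs_nonneg s
  have h1 : |p| * A ≤ |c| * A + δ := by nlinarith [mul_le_mul_of_nonneg_right hp' hA0]
  have h2 : |q| * B ≤ |s| * B + δ := by nlinarith [mul_le_mul_of_nonneg_right hq' hB0]
  have h3 := le_max_left |c| (|s| * b)
  have h4 := le_max_right |c| (|s| * b)
  have h5 : |c| * A ≤ |c| := by nlinarith
  have h6 : |s| * B ≤ |s| * b := by nlinarith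
  rcases le_or_gt A ε with h | h
  · have : |c| * A ≤ ε := by nlinarith
    linarith
  · have hB : B ≤ ε := by
      by_contra! hlt
      have : ε ^ 8 * ε ^ 4 < A ^ 8 * B ^ 4 := by gcongr
      rw [← pow_add] at this
      exact this.not_ge hAB
    have : |s| * B ≤ ε := by nlinarith
    linarith

/-- For the balanced product vector, whose overlap with |ψ₀⟩ is 1 and with |S₁⟩ is σ = sin θ. -/
lemma overlap_lower_left {σ p q c s ε δ : ℝ} (hσ0 : 0 ≤ σ) (hσ : σ ≤ ε)
    (hε : ε ≤ 1 / 4) (hδ : δ ≤ 2 * ε) (hp : |p - c| ≤ δ)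
    (hq : |q - s| ≤ δ) (hs : |s| ≤ 1) : |c| - 4 * ε ≤ |p + q * σ| := by
  have hp' : |c| ≤ |p| + δ := by
    linarith [abs_sub_abs_le_abs_sub c p, abs_sub_comm c p]
  have hq' : |q| ≤ |s| + δ := by linarith [abs_sub_abs_le_abs_sub q s]
  have h1 : |p| - |q * σ| ≤ |p + q * σ| := by
    have := abs_sub_abs_le_abs_sub p (-(q * σ))
    rwa [abs_neg, sub_neg_eq_add] at this
  rw [abs_mul, abs_of_nonneg hσ0] at h1
  nlinarith [abs_nonneg q]

/-- For the product vector attaining b = `BMax`. If b ≤ ε the left side is negative; otherwise the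
cross bound forces A ≤ ε. -/
lemma overlap_lower_right {A b p q c s ε δ : ℝ} (hε0 : 0 < ε) (hA0 : 0 ≤ A) (hb0 : 0 ≤ b)
    (hb : b ≤ 1) (hAB : A ^ 8 * b ^ 4 ≤ ε ^ 12)
    (hε : ε ≤ 1 / 4) (hδ : δ ≤ 2 * ε) (hp : |p - c| ≤ δ)
    (hq : |q - s| ≤ δ) (hc : |c| ≤ 1) (hs : |s| ≤ 1) : |s| * b - 4 * ε ≤ |p * A + q * b| := by
  rcases le_or_gt b ε with h | h
  · have : |s| * b ≤ ε := by nlinarith [abs_nonneg s]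
    linarith [abs_nonneg (p * A + q * b)]
  have hA : A ≤ ε := by
    by_contra! hlt
    have : ε ^ 8 * ε ^ 4 < A ^ 8 * b ^ 4 := by gcongr
    rw [← pow_add] at this
    exact this.not_ge hAB
  have hp' : |p| ≤ |c| + δ := by linarith [abs_sub_abs_le_abs_sub p c]
  have hq' : |s| ≤ |q| + δ := by
    linarith [abs_sub_abs_le_abs_sub s q, abs_sub_comm s q]
  have h1 : |q * b| - |p * A| ≤ |p * A + q * b| := by
    have := abs_sub_abs_le_abs_sub (q * b) (-(p * A))
    rwa [abs_neg, sub_neg_eq_add, add_comm (q * b)] at this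
  rw [abs_mul, abs_of_nonneg hb0, abs_mul, abs_of_nonneg hA0] at h1
  have h2 : |p| * A ≤ (1 + δ) * ε := by
    have := abs_nonneg p
    exact mul_le_mul (by linarith) hA hA0 (by linarith)
  have h3 : |s| * b ≤ |q| * b + δ := by
    have := (abs_nonneg _).trans hp
    nlinarith
  nlinarith

namespace SearchProblem

variable {P : SearchProblem}

lemma BMax_nonneg (P : SearchProblem) : 0 ≤ P.BMax := by
  obtain ⟨u, hu, h⟩ := P.exists_setOverlap_eq_BMax
  rw [← h]
  exact setOverlap_nonneg _ hu

lemma BMax_le_one (P : SearchProblem) : P.BMax ≤ 1 := by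
  obtain ⟨u, hu, h⟩ := P.exists_setOverlap_eq_BMax
  rw [← h]
  exact setOverlap_le_one _ hu

lemma sin_angle_le {ε : ℝ} (hε0 : 0 < ε) (hε : ε ≤ 1 / 4) (hr : P.M / P.N ≤ ε ^ 12) :
    Real.sin P.angle ≤ ε := by
  rw [sin_angle]
  refine Real.sqrt_le_iff.2 ⟨hε0.le, hr.trans ?_⟩
  exact pow_le_pow_of_le_one hε0.le (by linarith) (by norm_num)

lemma angle_mem (P : SearchProblem) : P.angle ∈ Set.Icc 0 (Real.pi / 2) :=
  ⟨Real.arcsin_nonneg.2 (Real.sqrt_nonneg _), Real.arcsin_le_pi_div_two _⟩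

lemma angle_pos (hne : P.marked.Nonempty) : 0 < P.angle :=
  Real.arcsin_pos.2 (Real.sqrt_pos.2 (div_pos (M_pos hne) N_pos))

lemma angle_le {ε : ℝ} (hε0 : 0 < ε) (hε : ε ≤ 1 / 4) (hr : P.M / P.N ≤ ε ^ 12) :
    P.angle ≤ 2 * ε := by
  have h1 := Real.mul_le_sin P.angle_mem.1 P.angle_mem.2
  have h2 := sin_angle_le hε0 hε hr
  have h3 : P.angle ≤ ε * (Real.pi / 2) := by
    have : P.angle = 2 / Real.pi * P.angle * (Real.pi / 2) := by
      field_simp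
    rw [this]
    exact mul_le_mul_of_nonneg_right (h1.trans h2) (by positivity)
  nlinarith [Real.pi_lt_four]

lemma amplitudes_close {ε : ℝ} (hε : ε ≤ 1 / 4) (hσ : Real.sin P.angle ≤ ε) (t : ℝ) :
    Real.cos P.angle ≠ 0 ∧
    |Real.cos (t + P.angle) / Real.cos P.angle - Real.cos t| ≤ 2 * ε ∧
    |Real.sin t / Real.cos P.angle - Real.sin t| ≤ 2 * ε := by
  have hs0 : 0 ≤ Real.sin P.angle := by rw [sin_angle]; exact Real.sqrt_nonneg _
  have hc0 : 0 ≤ Real.cos P.angle :=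
    Real.cos_nonneg_of_mem_Icc ⟨by linarith [P.angle_mem.1, Real.pi_pos], P.angle_mem.2⟩
  have h1 := Real.sin_sq_add_cos_sq P.angle
  have hle := Real.cos_le_one P.angle
  have hc : 1 - Real.sin P.angle ≤ Real.cos P.angle := by nlinarith
  have hpos : 0 < Real.cos P.angle := by linarith
  refine ⟨hpos.ne', ?_, ?_⟩
  · rw [div_sub' hpos.ne', abs_div, abs_of_pos hpos, div_le_iff₀ hpos,
      show Real.cos (t + P.angle) - Real.cos P.angle * Real.cos t = -(Real.sin t * Real.sin P.angle)
        by rw [Real.cos_add]; ring, abs_neg, abs_mul, abs_of_nonneg hs0]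
    nlinarith [Real.abs_sin_le_one t, abs_nonneg (Real.sin t)]
  · rw [div_sub' hpos.ne', abs_div, abs_of_pos hpos, div_le_iff₀ hpos,
      show Real.sin t - Real.cos P.angle * Real.sin t = Real.sin t * (1 - Real.cos P.angle) by ring,
      abs_mul, abs_of_nonneg (by linarith : 0 ≤ 1 - Real.cos P.angle)]
    nlinarith [Real.abs_sin_le_one t, abs_nonneg (Real.sin t)]

/-- The entanglement after `k` iterations, up to an error that vanishes as `M / N → 0`. -/
theorem abs_gme_sub_le (hne : P.marked.Nonempty) (hs : IsSymmetricState P.solutionState) {ε : ℝ}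
    (hε0 : 0 < ε) (hε : ε ≤ 1 / 4) (hr : P.M / P.N ≤ ε ^ 12) (k : ℕ) :
    |gme (P.stateAfter k) - (1 - limitOverlap P.BMax (2 * k * P.angle) ^ 2)| ≤ 20 * ε := by
  have hσ := sin_angle_le hε0 hε hr
  have hσ0 : 0 ≤ Real.sin P.angle := by rw [sin_angle]; exact Real.sqrt_nonneg _
  obtain ⟨hc, hp, hq⟩ := amplitudes_close hε hσ (2 * k * P.angle)
  have hin := inner_stateAfter hne hc k
  have hct := Real.abs_cos_le_one (2 * k * P.angle)
  have hst := Real.abs_sin_le_one (2 * k * P.angle)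
  have hm1 := limitOverlap_le_one P.BMax_le_one (2 * k * P.angle)
  have hm0 := limitOverlap_nonneg P.BMax (2 * k * P.angle)
  have hmdef : limitOverlap P.BMax (2 * k * P.angle) =
    max |Real.cos (2 * k * P.angle)| (|Real.sin (2 * k * P.angle)| * P.BMax) := rfl
  generalize limitOverlap P.BMax (2 * k * P.angle) = m at *
  generalize Real.cos (2 * k * P.angle + P.angle) / Real.cos P.angle = p at *
  generalize Real.sin (2 * k * P.angle) / Real.cos P.angle = q at *
  generalize Real.cos (2 * k * P.angle) = c at *
  generalize Real.sin (2 * k * P.angle) = s at *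
  have hcross : ∀ u : Fin P.n → Bool → ℝ, IsNonnegUnit u →
      setOverlap Finset.univ u ^ 8 * setOverlap P.marked u ^ 4 ≤ ε ^ 12 := fun u hu =>
    (univ_overlap_mul_setOverlap_le P.marked hu).trans hr
  obtain ⟨R, hR⟩ : ∃ R : Set ℝ, R = {r : ℝ | ∃ φ : Fin P.n → EuclideanSpace ℂ Bool,
      (∀ s, ‖φ s‖ = 1) ∧ r = ‖inner ℂ (P.stateAfter k) (productState φ)‖ ^ 2} := ⟨_, rfl⟩
  rw [gme, ← hR]
  -- 5ε is ε + 2δ from `overlap_upper` with δ = 2ε.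
  have hup : ∀ r ∈ R, r ≤ (m + 5 * ε) ^ 2 := by
    rw [hR]
    rintro r ⟨φ, hφ, rfl⟩
    have hu := isNonnegUnit_norm hφ
    refine pow_le_pow_left₀ (norm_nonneg _) ?_ 2
    rw [hin]
    refine (norm_add_le _ _).trans ?_
    rw [norm_mul, norm_mul, Complex.norm_real, Complex.norm_real, Real.norm_eq_abs,
      Real.norm_eq_abs]
    have h1 := overlap_upper hε0 (setOverlap_nonneg Finset.univ hu) (setOverlap_le_one _ hu)
      (setOverlap_nonneg P.marked hu) (setOverlap_marked_le_BMax hne hs hu) P.BMax_le_one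
      (hcross _ hu) hp hq hct hst
    have h2 := mul_le_mul_of_nonneg_left (norm_stateOverlap_productState_le Finset.univ φ)
      (abs_nonneg p)
    have h3 := mul_le_mul_of_nonneg_left (norm_stateOverlap_productState_le P.marked φ)
      (abs_nonneg q)
    rw [← hmdef] at h1
    linarith
  have hreal : ∀ u : Fin P.n → Bool → ℝ, IsNonnegUnit u →
      |p * setOverlap Finset.univ u + q * setOverlap P.marked u| ^ 2 ∈ R := by
    intro u hu
    rw [hR]
    refine ⟨realQubits u, norm_realQubits hu, ?_⟩
    rw [hin, stateOverlap_realQubits, stateOverlap_realQubits, ← Complex.ofReal_mul,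
      ← Complex.ofReal_mul, ← Complex.ofReal_add, Complex.norm_real, Real.norm_eq_abs]
  obtain ⟨v, hv, hvb⟩ := P.exists_setOverlap_eq_BMax
  have hsup := csSup_le ⟨_, hreal v hv⟩ hup
  have hreal' := fun u hu => le_csSup ⟨_, hup⟩ (hreal u hu)
  generalize sSup R = S at *
  have hlow : ∀ z, m - 4 * ε ≤ |z| → |z| ^ 2 ≤ S → m ^ 2 - 8 * ε ≤ S := by
    intro z h1 h2
    rcases le_or_gt (m - 4 * ε) 0 with h | h
    · nlinarith [abs_nonneg z, sq_nonneg z]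
    · nlinarith
  -- The larger branch of the maximum selects the witness: the maximiser of B or the balanced
  -- product.
  have hS : m ^ 2 - 8 * ε ≤ S := by
    rcases le_total |c| (|s| * P.BMax) with h | h
    · rw [max_eq_right h] at hmdef
      refine hlow _ ?_ (hreal' v hv)
      rw [hmdef, hvb]
      exact overlap_lower_right hε0 (setOverlap_nonneg _ hv) P.BMax_nonneg P.BMax_le_one
        (hvb ▸ hcross v hv) hε le_rfl hp hq hct hst
    · rw [max_eq_left h] at hmdef
      have hu := isNonnegUnit_balanced P.n
      refine hlow _ ?_ (hreal' _ hu)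
      rw [hmdef, setOverlap_balanced, setOverlap_balanced, card_univ_strings,
        div_self (by positivity), mul_one, ← Real.sqrt_div (Nat.cast_nonneg _)]
      rw [sin_angle] at hσ hσ0
      exact overlap_lower_left hσ0 hσ hε le_rfl hp hq hst
  rw [abs_le]
  constructor <;> nlinarith

/-! ### Rotation angle as a function of k/k_opt -/

lemma kOpt_spec (hpos : 0 < P.angle) (hlt : P.angle ≤ 1 / 2) :
    0 < P.kOpt ∧ |2 * P.kOpt * P.angle - Real.pi / 2| ≤ 2 * P.angle := by
  set z : ℝ := (Real.pi / (2 * P.angle) - 1) / 2 with hz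
  have h1 := abs_le.1 (abs_sub_round z)
  -- Before rounding the angle misses π/2 by θ; rounding adds at most θ. As z > 1/2, the rounded
  -- value is positive and `toNat` loses nothing.
  have hz' : 2 * z * P.angle = Real.pi / 2 - P.angle := by
    rw [hz]; field_simp
  have hz2 : 1 / 2 < z := by nlinarith [Real.pi_gt_three]
  have hr : (0 : ℝ) < round z := by linarith [h1.2]
  have hr' : 0 < round z := by exact_mod_cast hr
  have hk : (P.kOpt : ℤ) = round z := Int.toNat_of_nonneg hr'.le
  have hk' : (P.kOpt : ℝ) = round z := by exact_mod_cast hk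
  refine ⟨by omega, ?_⟩
  rw [hk', abs_le]
  constructor <;> nlinarith [h1.1, h1.2]

lemma abs_rotation_sub_le (hpos : 0 < P.angle) (hlt : P.angle ≤ 1 / 2) {k : ℕ} (hk : k ≤ P.kOpt) :
    |2 * k * P.angle - Real.pi / 2 * (k / P.kOpt)| ≤ 2 * P.angle := by
  obtain ⟨h0, h1⟩ := kOpt_spec hpos hlt
  have h0' : (0 : ℝ) < P.kOpt := by exact_mod_cast h0
  have hk' : (k : ℝ) / P.kOpt ≤ 1 := (div_le_one h0').2 (by exact_mod_cast hk)
  have e : 2 * k * P.angle - Real.pi / 2 * (k / P.kOpt) =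
      k / P.kOpt * (2 * P.kOpt * P.angle - Real.pi / 2) := by
    field_simp
  rw [e, abs_mul, abs_of_nonneg (by positivity)]
  nlinarith [abs_nonneg (2 * P.kOpt * P.angle - Real.pi / 2)]

end SearchProblem

/-! ### The two implications -/

theorem ScaleInvariant.of_bMaxIndependent {C : Set SearchProblem}
    (hne : ∀ P ∈ C, P.marked.Nonempty) (hsymm : ∀ P ∈ C, IsSymmetricState P.solutionState)
    (h : BMaxIndependent C) : ScaleInvariant C := by
  obtain ⟨c, hc⟩ := h
  refine ⟨fun x => 1 - limitOverlap c (Real.pi / 2 * x) ^ 2, fun ε hε => ?_⟩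
  -- The error is at most 20e + (2 + |c|)(4e + e) = (30 + 5|c|)e, where 4e bounds 2θ; one more e
  -- makes it strict.
  obtain ⟨e, he⟩ : ∃ e, e = min (1 / 4) (ε / (31 + 5 * |c|)) := ⟨_, rfl⟩
  have he0 : 0 < e := he ▸ lt_min (by norm_num) (by positivity)
  have he4 : e ≤ 1 / 4 := he ▸ min_le_left _ _
  have heε : e * (31 + 5 * |c|) ≤ ε := (le_div_iff₀ (by positivity)).1 (he ▸ min_le_right _ _)
  obtain ⟨δ, hδ, hδc⟩ := hc e he0
  refine ⟨min δ (e ^ 12), lt_min hδ (by positivity), fun P hP hr k hk => ?_⟩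
  have hr' := (lt_min_iff.1 hr).2.le
  have h1 := SearchProblem.abs_gme_sub_le (hne P hP) (hsymm P hP) he0 he4 hr' k
  have ha := SearchProblem.angle_le he0 he4 hr'
  have h2 := SearchProblem.abs_rotation_sub_le (SearchProblem.angle_pos (hne P hP))
    (by linarith) hk
  have h3 := abs_limitOverlap_sq_sub_le P.BMax_nonneg P.BMax_le_one c (2 * k * P.angle)
    (Real.pi / 2 * (k / P.kOpt))
  have h4 := hδc P hP (lt_min_iff.1 hr).1
  have h5 : (2 + |c|) * (|2 * k * P.angle - Real.pi / 2 * (k / P.kOpt)| + |P.BMax - c|)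
      ≤ (2 + |c|) * (5 * e) := by
    gcongr
    linarith
  rw [abs_lt]
  rw [abs_le] at h1 h3
  constructor <;> nlinarith [h1.1, h1.2, h3.1, h3.2]

theorem BMaxIndependent.of_scaleInvariant {C : Set SearchProblem}
    (hne : ∀ P ∈ C, P.marked.Nonempty) (hsymm : ∀ P ∈ C, IsSymmetricState P.solutionState)
    (h : ScaleInvariant C) : BMaxIndependent C := by
  obtain ⟨F, hF⟩ := h
  refine ⟨Real.sqrt (1 - F 1), fun ε hε => ?_⟩
  -- At k = `kOpt` the errors 20e and 12e total at most 0.32 ε², below the ε²/2 left over by `hδF`.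
  obtain ⟨e, he⟩ : ∃ e, e = min (1 / 4) (ε ^ 2 / 100) := ⟨_, rfl⟩
  have he0 : 0 < e := he ▸ lt_min (by norm_num) (by positivity)
  have he4 : e ≤ 1 / 4 := he ▸ min_le_left _ _
  have heε : e ≤ ε ^ 2 / 100 := he ▸ min_le_right _ _
  obtain ⟨δ, hδ, hδF⟩ := hF (ε ^ 2 / 2) (by positivity)
  refine ⟨min δ (e ^ 12), lt_min hδ (by positivity), fun P hP hr => ?_⟩
  have hr' := (lt_min_iff.1 hr).2.le
  have hθ := SearchProblem.angle_pos (hne P hP)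
  have ha := SearchProblem.angle_le he0 he4 hr'
  have h1 := SearchProblem.abs_gme_sub_le (hne P hP) (hsymm P hP) he0 he4 hr' P.kOpt
  obtain ⟨hk0, h2⟩ := SearchProblem.kOpt_spec hθ (by linarith)
  have hb0 := P.BMax_nonneg
  have hb1 := P.BMax_le_one
  have h3 := abs_limitOverlap_sq_sub_le hb0 hb1 P.BMax (2 * P.kOpt * P.angle) (Real.pi / 2)
  have h4 := hδF P hP (lt_min_iff.1 hr).1 P.kOpt le_rfl
  have hk0' : (P.kOpt : ℝ) ≠ 0 := by exact_mod_cast hk0.ne'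
  rw [div_self hk0'] at h4
  have h5 : limitOverlap P.BMax (Real.pi / 2) = P.BMax := by
    simp [limitOverlap, hb0]
  rw [h5, sub_self, abs_zero, add_zero, abs_of_nonneg hb0] at h3
  generalize P.BMax = b at *
  have h6 : |b ^ 2 - (1 - F 1)| < ε ^ 2 := by
    rw [abs_lt]
    rw [abs_le] at h1
    rw [abs_lt] at h4
    have h7 : |limitOverlap b (2 * P.kOpt * P.angle) ^ 2 - b ^ 2| ≤ 12 * e := by
      nlinarith [abs_nonneg (2 * P.kOpt * P.angle - Real.pi / 2)]
    rw [abs_le] at h7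
    constructor <;> linarith [h1.1, h1.2, h4.1, h4.2, h7.1, h7.2]
  -- For b, r ≥ 0, (b - r)² ≤ |b² - r²|. If 1 - F 1 ≤ 0, the root is 0 by convention and `h6` still
  -- gives b² < ε².
  refine abs_lt_of_sq_lt_sq ?_ hε.le
  rw [abs_lt] at h6
  rcases le_total 0 (1 - F 1) with h | h
  · have h8 := Real.sq_sqrt h
    have h9 := Real.sqrt_nonneg (1 - F 1)
    rcases le_total b (Real.sqrt (1 - F 1)) with h10 | h10 <;> nlinarith [h6.1, h6.2]
  · rw [Real.sqrt_eq_zero_of_nonpos h]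
    nlinarith [h6.1, h6.2]

end Grover

/-- For every class `C` of search problems with a nonempty set of marked items and a symmetric
superposition `|S₁⟩` of the marked items, the entanglement dynamics of Grover's algorithm for
`N ≫ M` is scale invariant if and only if, for `N ≫ M`, the maximum of `B` is independent of
`n`, `M` and the Hamming weights of the marked items. -/
theorem corollary1 (C : Set Grover.SearchProblem)
    (hne : ∀ P ∈ C, P.marked.Nonempty)
    (hsymm : ∀ P ∈ C, Grover.IsSymmetricState P.solutionState) :
    Grover.ScaleInvariant C ↔ Grover.BMaxIndependent C :=
  ⟨Grover.BMaxIndependent.of_scaleInvariant hne hsymm,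
    Grover.ScaleInvariant.of_bMaxIndependent hne hsymm⟩
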